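/- Let $f:\mathbb{R}^n\to\mathbb{R}$ be strictly concave and $g=(g_1,\dots,g_m):\mathbb{R}^n\to\mathbb{R}^m$ have convex components; assume that $f$ and all $g_i$ are continuously differentiable with locally Lipschitz gradients, and that Slater's condition holds: there is $x\in\mathbb{R}^n$ with $g_i(x)<0$ for all $i$. For $a\in\mathbb{R}$ and $b\ge 0$ put $[a]_b^+=a$ if $b>0$ and $[a]_b^+=\max\{0,a\}$ if $b=0$. The primal-dual dynamics on $D=\mathbb{R}^n\times\mathbb{R}^m_{\ge 0}$ is $$\dot x=\nabla f(x)-\sum_{i=1}^m\lambda_i\nabla g_i(x),\qquad \dot\lambda_i=[g_i(x)]_{\lambda_i}^+\quad(i=1,\dots,m).$$ A (Caratheodory) solution on $[0,T)$, $0<T\le\infty$, is a curve $[0,T)\to D$ that is absolutely continuous on every compact subinterval of $[0,T)$ and satisfies these equations for almost every $t\in[0,T)$. For a solution $\gamma$ on $[0,\infty)$, its omega-limit set $\Omega(\gamma)$ is the set of all $y\in\mathbb{R}^n\times\mathbb{R}^m$ for which there are $t_k\in[0,\infty)$ with $t_k\to\infty$ and $\gamma(t_k)\to y$. Then, for every solution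 $\gamma:[0,\infty)\to D$ of the primal-dual dynamics starting from any point of $D$, the set $\Omega(\gamma)$ is invariant under the primal-dual dynamics: every solution $\varphi$, on any interval $[0,T)$ with $0<T\le\infty$, with $\varphi(0)\in\Omega(\gamma)$ satisfies $\varphi(t)\in\Omega(\gamma)$ for all $t\in[0,T)$. -/

import Mathlib

open Filter Topology MeasureTheory

noncomputable section

namespace PrimalDual

section Caratheodory

variable {E : Type*} [NormedAddCommGroup E] [NormedSpace ℝ E]

/-- `γ` restricted to `[0, T)`, with `0 < T ≤ ∞`, is a Caratheodory solution of `γ' = F γ`, where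
the vector field `F` is considered on the domain `D` only: the curve takes its values in `D`, it is
absolutely continuous on every compact subinterval of `[0, T)`, and it satisfies the differential
equation for almost every `t` in `[0, T)`. The values of `γ` outside `[0, T)` are irrelevant. -/
structure IsCaratheodorySolution (F : E → E) (D : Set E) (T : EReal) (γ : ℝ → E) : Prop where
  pos : 0 < T
  mem : ∀ t : ℝ, 0 ≤ t → (t : EReal) < T → γ t ∈ D
  absolutelyContinuous :
    ∀ b : ℝ, 0 ≤ b → (b : EReal) < T → AbsolutelyContinuousOnInterval γ 0 b
  hasDerivAt :
    ∀ᵐ t : ℝ ∂volume, 0 ≤ t → (t : EReal) < T → HasDerivAt γ (F (γ t)) t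

/-- `S` is invariant: every solution, on whatever interval `[0, T)` it is defined, that starts at a
point of `S` remains in `S`. -/
def IsInvariant (F : E → E) (D : Set E) (S : Set E) : Prop :=
  ∀ (T : EReal) (γ : ℝ → E), IsCaratheodorySolution F D T γ → γ 0 ∈ S →
    ∀ t : ℝ, 0 ≤ t → (t : EReal) < T → γ t ∈ S

/-- The omega-limit set of a curve defined on `[0, ∞)`. -/
def omegaLimitSet (γ : ℝ → E) : Set E :=
  {y | ∃ t : ℕ → ℝ, (∀ k, 0 ≤ t k) ∧ Tendsto t atTop atTop ∧
    Tendsto (fun k => γ (t k)) atTop (𝓝 y)}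

end Caratheodory

/-- The operator `[a]_b^+`, equal to `a` for `b > 0` and to `max {0, a}` for `b = 0`.
It is only used for `b ≥ 0`. -/
def plusOperator (a b : ℝ) : ℝ := if 0 < b then a else max 0 a

/-- The domain `ℝⁿ × ℝ^m_{≥ 0}`. -/
def domain (n m : ℕ) : Set (EuclideanSpace ℝ (Fin n) × EuclideanSpace ℝ (Fin m)) :=
  {z | ∀ i, 0 ≤ z.2 i}

/-- The primal-dual vector field
`(x, μ) ↦ (∇ f x - ∑ i, μ i • ∇ (g i) x, [g x]_μ^+)`. -/
def vectorField {n m : ℕ} (f : EuclideanSpace ℝ (Fin n) → ℝ)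
    (g : Fin m → EuclideanSpace ℝ (Fin n) → ℝ)
    (z : EuclideanSpace ℝ (Fin n) × EuclideanSpace ℝ (Fin m)) :
    EuclideanSpace ℝ (Fin n) × EuclideanSpace ℝ (Fin m) :=
  (gradient f z.1 - ∑ i, z.2 i • gradient (g i) z.1,
    WithLp.toLp 2 fun i => plusOperator (g i z.1) (z.2 i))

end PrimalDual

end

/-!
Before its `μ`-component is projected onto the tangent cone of the orthant, the primal-dual vector
field is the saddle-point field of the Lagrangian `f - ∑ i, μ i * g i`, which for `μ ≥ 0` is concave
in `x` and is affine in `μ`. Such a field is dissipative and the projection keeps it so, hence the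
Euclidean distance between two solutions never grows. If `γ (τ k) → φ 0`, the shifted solutions
`t ↦ γ (τ k + t)` therefore stay as close to `φ` as they were at the start, so `γ (τ k + t) → φ t`.
-/

namespace PrimalDual

section AbsolutelyContinuous

variable {X Y : Type*} [PseudoMetricSpace X] [PseudoMetricSpace Y]

theorem absolutelyContinuousOnInterval_lipschitz_comp {K : NNReal} {h : X → Y}
    (hh : LipschitzWith K h) {u : ℝ → X} {a b : ℝ} (hu : AbsolutelyContinuousOnInterval u a b) :
    AbsolutelyContinuousOnInterval (h ∘ u) a b := by
  refine squeeze_zero (fun I => Finset.sum_nonneg fun i _ => dist_nonneg) (fun I => ?_)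
    (by simpa only [mul_zero] using Tendsto.const_mul (K : ℝ) hu)
  rw [Finset.mul_sum]
  exact Finset.sum_le_sum fun i _ => hh.dist_le_mul _ _

open Set in
theorem absolutelyContinuousOnInterval_comp_const_add {u : ℝ → X} {a b s : ℝ}
    (hu : AbsolutelyContinuousOnInterval u (s + a) (s + b)) :
    AbsolutelyContinuousOnInterval (fun t => u (s + t)) a b := by
  have image_uIoc (x y : ℝ) : uIoc (s + x) (s + y) = (s + ·) '' uIoc x y := by
    simp only [uIoc, image_const_add_Ioc, min_add_add_left, max_add_add_left]
  have mem_shift {x : ℝ} (hx : x ∈ uIcc a b) : s + x ∈ uIcc (s + a) (s + b) := by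
    rw [← image_const_add_uIcc]
    exact mem_image_of_mem _ hx
  rw [absolutelyContinuousOnInterval_iff] at hu ⊢
  intro ε hε
  obtain ⟨δ, hδ, hsum⟩ := hu ε hε
  refine ⟨δ, hδ, fun I ⟨hI_mem, hI_disj⟩ hIδ => ?_⟩
  refine hsum (I.1, fun i => (s + (I.2 i).1, s + (I.2 i).2)) ⟨fun i hi => ?_, ?_⟩ ?_
  · exact (hI_mem i hi).imp mem_shift mem_shift
  · intro i hi j hj hij
    simp only [Function.onFun, image_uIoc]
    exact (disjoint_image_iff (add_right_injective s)).2 (hI_disj hi hj hij)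
  · simpa only [dist_add_left] using hIδ

theorem le_of_ae_deriv_nonpos {V : ℝ → ℝ} {a b : ℝ} (hab : a ≤ b)
    (hV : AbsolutelyContinuousOnInterval V a b)
    (hV' : ∀ᵐ t : ℝ, t ∈ Set.Ioo a b → deriv V t ≤ 0) : V b ≤ V a := by
  have integral_nonpos : ∫ t in a..b, deriv V t ≤ ∫ _ in a..b, (0 : ℝ) := by
    refine intervalIntegral.integral_mono_ae_restrict hab hV.intervalIntegrable_deriv
      intervalIntegrable_const ?_
    rw [← restrict_Ioo_eq_restrict_Icc]
    exact (ae_restrict_iff' measurableSet_Ioo).2 hV'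
  rw [hV.integral_deriv_eq_sub, intervalIntegral.integral_zero] at integral_nonpos
  exact sub_nonpos.1 integral_nonpos

theorem norm_le_of_ae_inner_deriv_nonpos {H : Type*} [NormedAddCommGroup H]
    [InnerProductSpace ℝ H] {u u' : ℝ → H} {a b : ℝ} (hab : a ≤ b)
    (hu : AbsolutelyContinuousOnInterval u a b)
    (hderiv : ∀ᵐ t : ℝ, t ∈ Set.Ioo a b → HasDerivAt u (u' t) t)
    (hinner : ∀ᵐ t : ℝ, t ∈ Set.Ioo a b → inner ℝ (u t) (u' t) ≤ 0) : ‖u b‖ ≤ ‖u a‖ := by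
  have hnorm := absolutelyContinuousOnInterval_lipschitz_comp lipschitzWith_one_norm hu
  have hsq : AbsolutelyContinuousOnInterval (fun t => ‖u t‖ ^ 2) a b := by
    simpa only [pow_two, Function.comp_apply] using hnorm.fun_mul hnorm
  refine (sq_le_sq₀ (norm_nonneg _) (norm_nonneg _)).1 (le_of_ae_deriv_nonpos hab hsq ?_)
  filter_upwards [hderiv, hinner] with t hderiv_t hinner_t ht
  rw [(hderiv_t ht).norm_sq.deriv]
  exact mul_nonpos_of_nonneg_of_nonpos zero_le_two (hinner_t ht)

end AbsolutelyContinuous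

section Caratheodory

variable {E : Type*} [NormedAddCommGroup E] [NormedSpace ℝ E] {F : E → E} {D : Set E}
  {T : EReal} {γ φ : ℝ → E}

theorem IsCaratheodorySolution.mono {S : EReal} (hγ : IsCaratheodorySolution F D T γ)
    (hS : 0 < S) (hST : S ≤ T) : IsCaratheodorySolution F D S γ where
  pos := hS
  mem t ht htS := hγ.mem t ht (htS.trans_le hST)
  absolutelyContinuous b hb hbS := hγ.absolutelyContinuous b hb (hbS.trans_le hST)
  hasDerivAt := hγ.hasDerivAt.mono fun _ h ht htS => h ht (htS.trans_le hST)

theorem IsCaratheodorySolution.comp_const_add (hγ : IsCaratheodorySolution F D ⊤ γ) {s : ℝ}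
    (hs : 0 ≤ s) : IsCaratheodorySolution F D ⊤ (fun t => γ (s + t)) where
  pos := hγ.pos
  mem t ht _ := hγ.mem (s + t) (by positivity) (EReal.coe_lt_top _)
  absolutelyContinuous b hb _ := by
    have hac := hγ.absolutelyContinuous (s + b) (by positivity) (EReal.coe_lt_top _)
    have hs_mem : s + 0 ∈ Set.uIcc 0 (s + b) := Set.mem_uIcc.2 (.inl ⟨by simpa, by gcongr⟩)
    exact absolutelyContinuousOnInterval_comp_const_add
      (hac.mono (Set.uIcc_subset_uIcc_right hs_mem))
  hasDerivAt := by
    have hshift :=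
      (measurePreserving_add_left volume s).quasiMeasurePreserving.ae hγ.hasDerivAt
    filter_upwards [hshift] with t hderiv ht _
    exact (hderiv (by positivity) (EReal.coe_lt_top _)).comp_const_add s t

theorem isInvariant_omegaLimitSet_of_dist_le {C : ℝ}
    (hC : ∀ (T : EReal) (γ φ : ℝ → E), IsCaratheodorySolution F D T γ →
      IsCaratheodorySolution F D T φ → ∀ t : ℝ, 0 ≤ t → (t : EReal) < T →
        dist (γ t) (φ t) ≤ C * dist (γ 0) (φ 0))
    (hγ : IsCaratheodorySolution F D ⊤ γ) : IsInvariant F D (omegaLimitSet γ) := by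
  rintro T φ hφ ⟨τ, hτ_nonneg, hτ_top, hτ_lim⟩ t ht htT
  refine ⟨fun k => τ k + t, fun k => add_nonneg (hτ_nonneg k) ht,
    tendsto_atTop_add_const_right _ t hτ_top, ?_⟩
  have hdist (k : ℕ) : dist (γ (τ k + t)) (φ t) ≤ C * dist (γ (τ k)) (φ 0) := by
    simpa only [add_zero] using
      hC T _ φ ((hγ.comp_const_add (hτ_nonneg k)).mono hφ.pos le_top) hφ t ht htT
  have hbound : Tendsto (fun k => C * dist (γ (τ k)) (φ 0)) atTop (𝓝 0) := by
    simpa only [mul_zero] using (tendsto_iff_dist_tendsto_zero.1 hτ_lim).const_mul C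
  exact tendsto_iff_dist_tendsto_zero.2 (squeeze_zero (fun _ => dist_nonneg) hdist hbound)

variable {H : Type*} [NormedAddCommGroup H] [InnerProductSpace ℝ H] {L : E →L[ℝ] H}

/-- `F` is dissipative on `D` for the inner product of `H` pulled back along `L`. The map `L`
allows for spaces `E` whose norm does not come from an inner product, such as a product of
Euclidean spaces, which carries the maximum norm. -/
def IsDissipativeOn (L : E →L[ℝ] H) (F : E → E) (D : Set E) : Prop :=
  ∀ ⦃z⦄, z ∈ D → ∀ ⦃w⦄, w ∈ D → inner ℝ (L (z - w)) (L (F z - F w)) ≤ 0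

theorem IsDissipativeOn.norm_map_sub_le (hF : IsDissipativeOn L F D)
    (hγ : IsCaratheodorySolution F D T γ) (hφ : IsCaratheodorySolution F D T φ) {t : ℝ}
    (ht : 0 ≤ t) (htT : (t : EReal) < T) : ‖L (γ t - φ t)‖ ≤ ‖L (γ 0 - φ 0)‖ := by
  have hlt {s : ℝ} (hs : s ∈ Set.Ioo 0 t) : (s : EReal) < T :=
    (EReal.coe_lt_coe_iff.2 hs.2).trans htT
  have hac := absolutelyContinuousOnInterval_lipschitz_comp L.lipschitz
    ((hγ.absolutelyContinuous t ht htT).sub (hφ.absolutelyContinuous t ht htT))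
  refine norm_le_of_ae_inner_deriv_nonpos (u' := fun s => L (F (γ s) - F (φ s))) ht hac ?_ ?_
  · filter_upwards [hγ.hasDerivAt, hφ.hasDerivAt] with s hγs hφs hs
    exact L.hasFDerivAt.comp_hasDerivAt s
      ((hγs hs.1.le (hlt hs)).sub (hφs hs.1.le (hlt hs)))
  · exact Eventually.of_forall fun s hs =>
      hF (hγ.mem s hs.1.le (hlt hs)) (hφ.mem s hs.1.le (hlt hs))

theorem IsDissipativeOn.isInvariant_omegaLimitSet (hF : IsDissipativeOn L F D) {K : NNReal}
    (hL : AntilipschitzWith K L) (hγ : IsCaratheodorySolution F D ⊤ γ) :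
    IsInvariant F D (omegaLimitSet γ) := by
  refine isInvariant_omegaLimitSet_of_dist_le (C := K * ‖L‖) (fun T ψ φ hψ hφ t ht htT => ?_) hγ
  calc dist (ψ t) (φ t) ≤ K * ‖L (ψ t - φ t)‖ := by
        simpa only [dist_eq_norm, map_sub] using hL.le_mul_dist (ψ t) (φ t)
    _ ≤ K * ‖L (ψ 0 - φ 0)‖ := by gcongr; exact hF.norm_map_sub_le hψ hφ ht htT
    _ ≤ K * (‖L‖ * ‖ψ 0 - φ 0‖) := by gcongr; exact L.le_opNorm _
    _ = K * ‖L‖ * dist (ψ 0) (φ 0) := by rw [dist_eq_norm, mul_assoc]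

end Caratheodory

section Convex

variable {E : Type*} [NormedAddCommGroup E] [NormedSpace ℝ E] {s : Set E} {f : E → ℝ} {x y : E}
  {fx' fy' : E →L[ℝ] ℝ}

theorem map_sub_le_sub_of_convexOn (hf : ConvexOn ℝ s f) (hx : x ∈ s) (hy : y ∈ s)
    (hfx : HasFDerivAt f fx' x) : fx' (y - x) ≤ f y - f x := by
  have hconv := hf.comp_affineMap (AffineMap.lineMap (k := ℝ) x y)
  have hderiv : HasDerivAt (f ∘ AffineMap.lineMap (k := ℝ) x y) (fx' (y - x)) 0 :=
    HasFDerivAt.comp_hasDerivAt 0 (by rwa [AffineMap.lineMap_apply_zero])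
      AffineMap.hasDerivAt_lineMap
  simpa [slope_def_field] using
    hconv.le_slope_of_hasDerivAt (by simpa using hx) (by simpa using hy) one_pos hderiv

theorem sub_mul_sub_le_of_convexOn (hf : ConvexOn ℝ s f) (hx : x ∈ s) (hy : y ∈ s)
    (hfx : HasFDerivAt f fx' x) (hfy : HasFDerivAt f fy' y) {a b : ℝ} (ha : 0 ≤ a) (hb : 0 ≤ b) :
    (a - b) * (f x - f y) ≤ a * fx' (x - y) - b * fy' (x - y) := by
  have hle_x : f x - f y ≤ fx' (x - y) := by
    have := map_sub_le_sub_of_convexOn hf hx hy hfx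
    rw [← neg_sub x y, map_neg] at this
    linarith
  have hy_le : fy' (x - y) ≤ f x - f y := map_sub_le_sub_of_convexOn hf hy hx hfy
  calc (a - b) * (f x - f y) = a * (f x - f y) - b * (f x - f y) := sub_mul _ _ _
    _ ≤ a * fx' (x - y) - b * fy' (x - y) := by gcongr

theorem sub_map_sub_nonpos_of_concaveOn (hf : ConcaveOn ℝ s f) (hx : x ∈ s) (hy : y ∈ s)
    (hfx : HasFDerivAt f fx' x) (hfy : HasFDerivAt f fy' y) :
    fx' (x - y) - fy' (x - y) ≤ 0 := by
  have := sub_mul_sub_le_of_convexOn hf.neg hx hy hfx.neg hfy.neg zero_le_one zero_le_one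
  simp only [sub_self, zero_mul, one_mul, neg_apply] at this
  linarith

end Convex

section PrimalDualField

/-- `plusOperator a b` is the projection of `a` onto the tangent cone of `[0, ∞)` at `b`, and this
is its variational inequality. -/
theorem sub_mul_plusOperator_sub_nonpos (a : ℝ) {b c : ℝ} (hb : 0 ≤ b) (hc : 0 ≤ c) :
    (b - c) * (plusOperator a b - a) ≤ 0 := by
  obtain hb_pos | rfl := hb.lt_or_eq
  · simp only [plusOperator, if_pos hb_pos, sub_self, mul_zero, le_refl]
  · simp only [plusOperator, lt_self_iff_false, if_false]
    exact mul_nonpos_of_nonpos_of_nonneg (by linarith) (sub_nonneg.2 (le_max_right 0 a))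

theorem sub_mul_plusOperator_sub_plusOperator_le (a a' : ℝ) {b b' : ℝ} (hb : 0 ≤ b)
    (hb' : 0 ≤ b') :
    (b - b') * (plusOperator a b - plusOperator a' b') ≤ (b - b') * (a - a') := by
  have h := sub_mul_plusOperator_sub_nonpos a hb hb'
  have h' := sub_mul_plusOperator_sub_nonpos a' hb' hb
  linarith

variable {n m : ℕ} {f : EuclideanSpace ℝ (Fin n) → ℝ} {g : Fin m → EuclideanSpace ℝ (Fin n) → ℝ}

theorem inner_toLp_sub_vectorField_sub
    (z w : EuclideanSpace ℝ (Fin n) × EuclideanSpace ℝ (Fin m)) :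
    inner ℝ (WithLp.toLp 2 (z - w)) (WithLp.toLp 2 (vectorField f g z - vectorField f g w)) =
      (fderiv ℝ f z.1 (z.1 - w.1) - fderiv ℝ f w.1 (z.1 - w.1)) +
      ∑ i, ((z.2 i - w.2 i) * (plusOperator (g i z.1) (z.2 i) - plusOperator (g i w.1) (w.2 i)) -
        (z.2 i * fderiv ℝ (g i) z.1 (z.1 - w.1) - w.2 i * fderiv ℝ (g i) w.1 (z.1 - w.1))) := by
  have hprimal : inner ℝ (z.1 - w.1) (vectorField f g z - vectorField f g w).1 =
      (fderiv ℝ f z.1 (z.1 - w.1) - fderiv ℝ f w.1 (z.1 - w.1)) -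
      ∑ i, (z.2 i * fderiv ℝ (g i) z.1 (z.1 - w.1) - w.2 i * fderiv ℝ (g i) w.1 (z.1 - w.1)) := by
    rw [real_inner_comm]
    simp only [vectorField, Prod.fst_sub, inner_sub_left, sum_inner, real_inner_smul_left,
      inner_gradient_left, Finset.sum_sub_distrib]
    ring
  have hdual : inner ℝ (z.2 - w.2) (vectorField f g z - vectorField f g w).2 =
      ∑ i, (z.2 i - w.2 i) *
        (plusOperator (g i z.1) (z.2 i) - plusOperator (g i w.1) (w.2 i)) := by
    simp [PiLp.inner_apply, vectorField, mul_comm]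
  calc inner ℝ (WithLp.toLp 2 (z - w)) (WithLp.toLp 2 (vectorField f g z - vectorField f g w))
      = inner ℝ (z.1 - w.1) (vectorField f g z - vectorField f g w).1 +
          inner ℝ (z.2 - w.2) (vectorField f g z - vectorField f g w).2 :=
        WithLp.prod_inner_apply _ _
    _ = _ := by
      rw [hprimal, hdual, sub_add_eq_add_sub, add_sub_assoc, ← Finset.sum_sub_distrib]

theorem isDissipativeOn_vectorField (hf : Differentiable ℝ f) (hg : ∀ i, Differentiable ℝ (g i))
    (hf_concave : ConcaveOn ℝ Set.univ f) (hg_convex : ∀ i, ConvexOn ℝ Set.univ (g i)) :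
    IsDissipativeOn (WithLp.prodContinuousLinearEquiv 2 ℝ (EuclideanSpace ℝ (Fin n))
      (EuclideanSpace ℝ (Fin m))).symm.toContinuousLinearMap (vectorField f g) (domain n m) := by
  intro z hz w hw
  refine (inner_toLp_sub_vectorField_sub z w).trans_le
    (add_nonpos ?_ (Finset.sum_nonpos fun i _ => sub_nonpos.2 ?_))
  · exact sub_map_sub_nonpos_of_concaveOn hf_concave (Set.mem_univ _) (Set.mem_univ _)
      (hf z.1).hasFDerivAt (hf w.1).hasFDerivAt
  · exact (sub_mul_plusOperator_sub_plusOperator_le _ _ (hz i) (hw i)).trans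
      (sub_mul_sub_le_of_convexOn (hg_convex i) (Set.mem_univ _) (Set.mem_univ _)
        (hg i z.1).hasFDerivAt (hg i w.1).hasFDerivAt (hz i) (hw i))

end PrimalDualField

end PrimalDual

theorem mainTheorem3_general {n m : ℕ}
    {f : EuclideanSpace ℝ (Fin n) → ℝ} {g : Fin m → EuclideanSpace ℝ (Fin n) → ℝ}
    (hf : Differentiable ℝ f) (hg : ∀ i, Differentiable ℝ (g i))
    (hf_concave : ConcaveOn ℝ Set.univ f) (hg_convex : ∀ i, ConvexOn ℝ Set.univ (g i))
    {γ : ℝ → EuclideanSpace ℝ (Fin n) × EuclideanSpace ℝ (Fin m)}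
    (hγ : PrimalDual.IsCaratheodorySolution (PrimalDual.vectorField f g)
      (PrimalDual.domain n m) ⊤ γ) :
    PrimalDual.IsInvariant (PrimalDual.vectorField f g) (PrimalDual.domain n m)
      (PrimalDual.omegaLimitSet γ) :=
  (PrimalDual.isDissipativeOn_vectorField hf hg hf_concave hg_convex).isInvariant_omegaLimitSet
    (WithLp.prodContinuousLinearEquiv 2 ℝ (EuclideanSpace ℝ (Fin n))
      (EuclideanSpace ℝ (Fin m))).symm.antilipschitz hγ

theorem mainTheorem3 (n m : ℕ)
    (f : EuclideanSpace ℝ (Fin n) → ℝ) (g : Fin m → EuclideanSpace ℝ (Fin n) → ℝ)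
    (hf : ContDiff ℝ 1 f) (hg : ∀ i, ContDiff ℝ 1 (g i))
    (hf_concave : StrictConcaveOn ℝ Set.univ f)
    (hg_convex : ∀ i, ConvexOn ℝ Set.univ (g i))
    (hf_lip : LocallyLipschitz (gradient f))
    (hg_lip : ∀ i, LocallyLipschitz (gradient (g i)))
    (hslater : ∃ x, ∀ i, g i x < 0)
    (γ : ℝ → EuclideanSpace ℝ (Fin n) × EuclideanSpace ℝ (Fin m))
    (hγ : PrimalDual.IsCaratheodorySolution (PrimalDual.vectorField f g)
      (PrimalDual.domain n m) ⊤ γ)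
    (hγ0 : γ 0 ∈ PrimalDual.domain n m) :
    PrimalDual.IsInvariant (PrimalDual.vectorField f g) (PrimalDual.domain n m)
      (PrimalDual.omegaLimitSet γ) := by
  exact mainTheorem3_general (hf.differentiable one_ne_zero)
    (fun i => (hg i).differentiable one_ne_zero) hf_concave.concaveOn hg_convex hγ
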